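/- Let $\mathbb{N}=\{0,1,2,\dots\}$ and let $\beta\mathbb{N}$ be the space of ultrafilters on $\mathbb{N}$, with the compact Hausdorff topology whose basic open sets are $\overline{A}=\{p\in\beta\mathbb{N}: A\in p\}$, $A\subseteq\mathbb{N}$, and with the addition given by $A\in q+p \iff \{m\in\mathbb{N} : \{n\in\mathbb{N}: m+n\in A\}\in p\}\in q$. A two-sided ideal is a nonempty set $I\subseteq\beta\mathbb{N}$ with $p+I\subseteq I$ and $I+p\subseteq I$ for all $p\in\beta\mathbb{N}$. A counting measure is a Radon measure $\mu$ on $\beta\mathbb{N}$ for which there is an ultrafilter $q$ on $\mathbb{N}^+\times\mathbb{N}$ such that $$\mu(\overline{A})=\lim_{(N,M)\to q}\frac{|A\cap[M+1,M+N]|}{N}\quad\text{for all } A\subseteq\mathbb{N},$$ such that $\lim_{(N,M)\to q}\frac1N=0$, and such that either $\lim_{(N,M)\to q}M=M_0$ for some $M_0<\infty$, or $q$ contains a set $\{(N_1,M_1),(N_2,M_2),\dots\}$ with $M_i+N_i<M_{i+1}$ and $N_i<N_{i+1}$ for all $i\ge 1$. For $k\in\mathbb{N}$ let $AP_k\subseteq\beta\mathbb{N}$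 be the set of ultrafilters all of whose members contain an arithmetic progression $a,a+b,\dots,a+(k-1)b$ with $a,b\in\mathbb{N}$, $b>0$. Theorem 4.3.4 (The minimal two-sided ideal $\kappa(\beta\mathbb{N})$ is a null set). The semigroup $(\beta\mathbb{N},+)$ has a smallest two-sided ideal $\kappa(\beta\mathbb{N})$, and it is a null set for every counting measure $\mu$: $\mu(\kappa(\beta\mathbb{N}))=0$ (in the sense of outer measure: $\kappa(\beta\mathbb{N})$ is contained in a Borel set of measure $0$). In particular, for every $k\in\mathbb{N}$ the inclusion $\kappa(\beta\mathbb{N})\subseteq AP_k$ holds, but for a counting measure $\mu$ it yields only the trivial lower bound $0=\mu(\kappa(\beta\mathbb{N}))\le\mu(AP_k)$, whereas $\mu(\beta\mathbb{N})=1$. -/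

import Mathlib

open Filter Topology MeasureTheory

/- The sum of ultrafilters: `A ∈ p + q` iff `{m | {n | m + n ∈ A} ∈ q} ∈ p`. -/
attribute [local instance] Ultrafilter.add

namespace BetaNat

/-- A two-sided ideal of `(βℕ, +)`: a nonempty set of ultrafilters that absorbs addition on
either side. -/
structure IsTwoSidedIdeal (I : Set (Ultrafilter ℕ)) : Prop where
  nonempty : I.Nonempty
  add_mem_left : ∀ p : Ultrafilter ℕ, ∀ q ∈ I, p + q ∈ I
  add_mem_right : ∀ p : Ultrafilter ℕ, ∀ q ∈ I, q + p ∈ I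

/-- `κ(βℕ)`: the intersection of all two-sided ideals of `(βℕ, +)`. It is the smallest two-sided
ideal as soon as it is itself a two-sided ideal. -/
def kappa : Set (Ultrafilter ℕ) :=
  ⋂₀ {I | IsTwoSidedIdeal I}

/-- `A` contains an arithmetic progression `a, a + b, …, a + (k - 1) b` with `b > 0`. -/
def ContainsAP (k : ℕ) (A : Set ℕ) : Prop :=
  ∃ a b : ℕ, 0 < b ∧ ∀ j < k, a + j * b ∈ A

/-- `AP_k`: the ultrafilters all of whose members contain an arithmetic progression of
length `k`. -/
def progressionRich (k : ℕ) : Set (Ultrafilter ℕ) :=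
  {p | ∀ A ∈ p, ContainsAP k A}

/-- The basic clopen set `Ā` of all ultrafilters that contain `A`. -/
def basicOpen (A : Set ℕ) : Set (Ultrafilter ℕ) :=
  {p | A ∈ p}

/-- The ratio `|A ∩ [M + 1, M + N]| / N` for a pair `x = (N, M)`. -/
noncomputable def intervalDensity (A : Set ℕ) (x : ℕ+ × ℕ) : ℝ :=
  ((A ∩ Set.Icc (x.2 + 1) (x.2 + x.1)).ncard : ℝ) / ((x.1 : ℕ) : ℝ)

/-- The conditions on the ultrafilter `q` on pairs `(N, M)`, a pair standing for the interval
`[M + 1, M + N]`, that defines a counting measure: the length `N` tends to infinity along `q`;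
and either the starting points `M` have a finite limit along `q`, or some infinite sequence of
successive disjoint intervals of strictly increasing lengths is a member of `q`. -/
structure IsAdmissible (q : Ultrafilter (ℕ+ × ℕ)) : Prop where
  length_tendsto : Tendsto (fun x : ℕ+ × ℕ => 1 / ((x.1 : ℕ) : ℝ)) q (𝓝 0)
  starts : (∃ M₀ : ℕ, Tendsto (fun x : ℕ+ × ℕ => x.2) q (𝓝 M₀)) ∨
    ∃ (N : ℕ → ℕ+) (M : ℕ → ℕ), (∀ i, M i + N i < M (i + 1)) ∧ StrictMono N ∧
      Set.range (fun i => (N i, M i)) ∈ q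

/-- A counting measure on `βℕ`: a Radon measure on the Borel sets for which
`μ(Ā) = lim_{(N, M) → q} |A ∩ [M + 1, M + N]| / N` for all `A ⊆ ℕ`, for some admissible `q`.
(`Measure.Regular` includes finiteness on compact sets, so a regular measure on the compact
space `βℕ` is finite and `μ.real` is its value.) -/
structure IsCountingMeasure [MeasurableSpace (Ultrafilter ℕ)] [BorelSpace (Ultrafilter ℕ)]
    (μ : Measure (Ultrafilter ℕ)) : Prop where
  regular : μ.Regular
  exists_ultrafilter : ∃ q : Ultrafilter (ℕ+ × ℕ), IsAdmissible q ∧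
    ∀ A : Set ℕ, Tendsto (intervalDensity A) q (𝓝 (μ.real (basicOpen A)))

end BetaNat

/-! By compactness, minimal closed left ideals exist; their union is a two-sided ideal inside every
other one, so it is `kappa`. Each of its elements is `y + f` with `f` idempotent, and `f` contains
all tails and all sets `bℕ` with `b > 0`. Hence `y + f` contains the union over `t` of `t + b t ℕ`
cut off below `s t`, for any positive moduli and any thresholds. With `b t = c * 2 ^ t` and
thresholds so late that only moduli at most `N` meet an interval of length `N`, this union has
density at most `4 / c`; let `c → ∞`. The inclusion in `progressionRich k` holds because that set is
itself a two-sided ideal, nonempty by van der Waerden and compactness. -/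

section MinimalLeftIdeals

variable {S : Type*} [AddSemigroup S] [TopologicalSpace S]

/-- A minimal element among the nonempty closed left ideals of a topological semigroup. -/
def IsMinimalClosedLeftIdeal (L : Set S) : Prop :=
  Minimal (fun J : Set S => IsClosed J ∧ J.Nonempty ∧ ∀ p, ∀ x ∈ J, p + x ∈ J) L

theorem exists_isMinimalClosedLeftIdeal [CompactSpace S] [Nonempty S] :
    ∃ L : Set S, IsMinimalClosedLeftIdeal L := by
  refine zorn_superset {J : Set S | IsClosed J ∧ J.Nonempty ∧ ∀ p, ∀ x ∈ J, p + x ∈ J}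
    fun c hcs hc => ?_
  refine ⟨⋂₀ c, ⟨isClosed_sInter fun t ht => (hcs ht).1, ?_, fun p x hx t ht =>
    (hcs ht).2.2 p x (hx t ht)⟩, fun s hs => Set.sInter_subset_of_mem hs⟩
  obtain rfl | hne := c.eq_empty_or_nonempty
  · rw [Set.sInter_empty]
    exact Set.univ_nonempty
  · have := hne.to_subtype
    exact IsCompact.nonempty_sInter_of_directed_nonempty_isCompact_isClosed
      (IsChain.directedOn hc.symm) (fun t ht => (hcs ht).2.1)
      (fun t ht => (hcs ht).1.isCompact) (fun t ht => (hcs ht).1)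

namespace IsMinimalClosedLeftIdeal

variable [CompactSpace S] [T2Space S] {L : Set S}

/-- A minimal closed left ideal is generated by each of its elements. -/
theorem range_add_eq (hL : IsMinimalClosedLeftIdeal L)
    (hcont : ∀ r : S, Continuous (· + r)) {x : S} (hx : x ∈ L) :
    Set.range (· + x) = L := by
  refine hL.eq_of_subset ⟨(isCompact_range (hcont x)).isClosed, ⟨_, ⟨x, rfl⟩⟩, ?_⟩ ?_
  · rintro p _ ⟨y, rfl⟩
    exact ⟨p + y, add_assoc _ _ _⟩
  · rintro _ ⟨y, rfl⟩
    exact hL.prop.2.2 y x hx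

theorem image_add_right (hL : IsMinimalClosedLeftIdeal L)
    (hcont : ∀ r : S, Continuous (· + r)) (p : S) :
    IsMinimalClosedLeftIdeal ((· + p) '' L) := by
  obtain ⟨hclosed, hne, hadd⟩ := hL.prop
  refine ⟨⟨(hclosed.isCompact.image (hcont p)).isClosed, hne.image _, ?_⟩, ?_⟩
  · rintro r _ ⟨x, hx, rfl⟩
    exact ⟨r + x, hadd r x hx, add_assoc _ _ _⟩
  · rintro J ⟨hJclosed, ⟨y, hy⟩, hJadd⟩ hJ
    obtain ⟨x₀, hx₀, rfl⟩ := hJ hy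
    -- The part of `L` that translates into `J` is again a closed left ideal, so minimality makes it
    -- all of `L`.
    have h : L ∩ (· + p) ⁻¹' J = L := by
      refine hL.eq_of_subset
        ⟨hclosed.inter (hJclosed.preimage (hcont p)), ⟨x₀, hx₀, hy⟩, ?_⟩ Set.inter_subset_left
      rintro r x ⟨hx, hxJ⟩
      refine ⟨hadd r x hx, ?_⟩
      change r + x + p ∈ J
      rw [add_assoc]
      exact hJadd r _ hxJ
    rintro _ ⟨x, hx, rfl⟩
    rw [← h] at hx
    exact hx.2

/-- Every element of a minimal closed left ideal has an idempotent of that ideal as a right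
summand. -/
theorem exists_idempotent (hL : IsMinimalClosedLeftIdeal L)
    (hcont : ∀ r : S, Continuous (· + r)) {x : S} (hx : x ∈ L) :
    ∃ f ∈ L, f + f = f ∧ ∃ y, x = y + f := by
  obtain ⟨hclosed, hne, hadd⟩ := hL.prop
  obtain ⟨f, hf, hff⟩ := exists_idempotent_in_compact_add_subsemigroup hcont L hne
    hclosed.isCompact fun a _ b hb => hadd a b hb
  rw [← hL.range_add_eq hcont hf] at hx
  obtain ⟨y, rfl⟩ := hx
  exact ⟨f, hf, hff, y, rfl⟩

end IsMinimalClosedLeftIdeal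

end MinimalLeftIdeals

attribute [local instance] Ultrafilter.addSemigroup

namespace BetaNat

/-- The union of all minimal closed left ideals of `βℕ`. -/
def minimalLeftIdealUnion : Set (Ultrafilter ℕ) :=
  {p | ∃ L : Set (Ultrafilter ℕ), IsMinimalClosedLeftIdeal L ∧ p ∈ L}

theorem isTwoSidedIdeal_minimalLeftIdealUnion : IsTwoSidedIdeal minimalLeftIdealUnion where
  nonempty := by
    obtain ⟨L, hL⟩ := exists_isMinimalClosedLeftIdeal (S := Ultrafilter ℕ)
    obtain ⟨p, hp⟩ := hL.prop.2.1
    exact ⟨p, L, hL, hp⟩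
  add_mem_left := by
    rintro p q ⟨L, hL, hq⟩
    exact ⟨L, hL, hL.prop.2.2 p q hq⟩
  add_mem_right := by
    rintro p q ⟨L, hL, hq⟩
    exact ⟨_, hL.image_add_right Ultrafilter.continuous_add_left p, ⟨q, hq, rfl⟩⟩

theorem minimalLeftIdealUnion_subset {I : Set (Ultrafilter ℕ)} (hI : IsTwoSidedIdeal I) :
    minimalLeftIdealUnion ⊆ I := by
  rintro p ⟨L, hL, hp⟩
  obtain ⟨i, hi⟩ := hI.nonempty
  -- `i + p` lies in both `I` and `L`, and it generates `L`.
  rw [← hL.range_add_eq Ultrafilter.continuous_add_left (hL.prop.2.2 i p hp)] at hp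
  obtain ⟨r, hr⟩ := hp
  exact hr ▸ hI.add_mem_left _ _ (hI.add_mem_right _ _ hi)

theorem kappa_eq_minimalLeftIdealUnion : kappa = minimalLeftIdealUnion :=
  Set.Subset.antisymm (Set.sInter_subset_of_mem isTwoSidedIdeal_minimalLeftIdealUnion)
    (Set.subset_sInter fun _ hI => minimalLeftIdealUnion_subset hI)

theorem isLeast_kappa : IsLeast {I : Set (Ultrafilter ℕ) | IsTwoSidedIdeal I} kappa :=
  ⟨kappa_eq_minimalLeftIdealUnion ▸ isTwoSidedIdeal_minimalLeftIdealUnion,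
    fun _ hI => Set.sInter_subset_of_mem hI⟩

/-! ### Small sets containing `kappa` -/

theorem mem_add_iff {p q : Ultrafilter ℕ} {A : Set ℕ} :
    A ∈ p + q ↔ ∀ᶠ m in p, ∀ᶠ n in q, m + n ∈ A :=
  Iff.rfl

theorem isTwoSidedIdeal_le_atTop :
    IsTwoSidedIdeal {p : Ultrafilter ℕ | ∀ n, Set.Ici n ∈ p} where
  nonempty := ⟨hyperfilter ℕ, fun n =>
    mem_hyperfilter_of_finite_compl (by simp [Set.finite_Iio])⟩
  add_mem_left p q hq n := mem_add_iff.2 <| Eventually.of_forall fun m =>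
    mem_of_superset (hq n) fun k (hk : n ≤ k) => show n ≤ m + k by omega
  add_mem_right p q hq n := mem_add_iff.2 <|
    mem_of_superset (hq n) fun m (hm : n ≤ m) =>
      Eventually.of_forall fun k => show n ≤ m + k by omega

/-- An idempotent ultrafilter on `ℕ` contains all the sets `bℕ` with `b > 0`. -/
theorem eventually_dvd_of_add_self {f : Ultrafilter ℕ} (hf : f + f = f) {b : ℕ} (hb : 0 < b) :
    ∀ᶠ n in f, b ∣ n := by
  have : NeZero b := ⟨hb.ne'⟩
  obtain ⟨r, hr⟩ : ∃ r : ZMod b, ∀ᶠ n : ℕ in f, (n : ZMod b) = r := by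
    have h : ∀ᶠ n : ℕ in f, ∃ r ∈ (Set.univ : Set (ZMod b)), (n : ZMod b) = r :=
      Eventually.of_forall fun n => ⟨_, trivial, rfl⟩
    obtain ⟨r, -, hr⟩ := (Ultrafilter.eventually_exists_mem_iff Set.finite_univ).1 h
    exact ⟨r, hr⟩
  have hr' : ∀ᶠ m in f, ∀ᶠ n in f, ((m + n : ℕ) : ZMod b) = r := by
    have : {n : ℕ | (n : ZMod b) = r} ∈ f + f := by rw [hf]; exact hr
    exact this
  obtain ⟨m, hm, hm'⟩ := (hr.and hr').exists
  obtain ⟨n, hn, hn'⟩ := (hr.and hm').exists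
  -- Idempotence passes to the residue class: `r + r = r`.
  have hr0 : r = 0 := by
    rw [Nat.cast_add, hm, hn] at hn'
    simpa using hn'
  filter_upwards [hr] with k hk
  rwa [hr0, ZMod.natCast_eq_zero_iff] at hk

theorem exists_eq_add_of_mem_kappa {p : Ultrafilter ℕ} (hp : p ∈ kappa) :
    ∃ y f : Ultrafilter ℕ, p = y + f ∧ (∀ n, Set.Ici n ∈ f) ∧
      ∀ b, 0 < b → ∀ᶠ n in f, b ∣ n := by
  rw [kappa_eq_minimalLeftIdealUnion] at hp
  obtain ⟨L, hL, hp⟩ := hp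
  obtain ⟨f, hfL, hff, y, rfl⟩ := hL.exists_idempotent Ultrafilter.continuous_add_left hp
  exact ⟨y, f, rfl, minimalLeftIdealUnion_subset isTwoSidedIdeal_le_atTop ⟨L, hL, hfL⟩,
    fun b hb => eventually_dvd_of_add_self hff hb⟩

/-- The union over `t` of the progressions `t + b t ℕ`, truncated below `s t`. -/
def truncatedProgressions (b s : ℕ → ℕ) : Set ℕ :=
  {x | ∃ t, s t ≤ x ∧ t ≤ x ∧ x ≡ t [MOD b t]}

/-- Each `t` starts its own progression, so nothing about `y` matters: `t + n` is in the set for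
`f`-most `n`. -/
theorem kappa_subset_basicOpen_truncatedProgressions {b : ℕ → ℕ} (hb : ∀ t, 0 < b t)
    (s : ℕ → ℕ) : kappa ⊆ basicOpen (truncatedProgressions b s) := by
  intro p hp
  obtain ⟨y, f, rfl, hf, hfb⟩ := exists_eq_add_of_mem_kappa hp
  refine mem_add_iff.2 (Eventually.of_forall fun t => ?_)
  filter_upwards [hf (s t), hfb (b t) (hb t)] with n hn hdvd
  have hn : s t ≤ n := hn
  refine ⟨t, by omega, by omega, ?_⟩
  simpa using (Nat.modEq_zero_iff_dvd.2 hdvd).add_left t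

/-! ### Density estimates -/

/-- Along an admissible ultrafilter, intervals reaching far to the right are long. -/
theorem IsAdmissible.exists_mem_length {q : Ultrafilter (ℕ+ × ℕ)} (hq : IsAdmissible q) :
    ∃ S ∈ q, ∀ b : ℕ, ∃ n : ℕ, ∀ x ∈ S, n ≤ x.2 + x.1 → b ≤ (x.1 : ℕ) := by
  rcases hq.starts with ⟨M₀, h⟩ | ⟨N, M, hM, hN, hS⟩
  · refine ⟨{x | x.2 = M₀}, ?_, fun b => ⟨M₀ + b, ?_⟩⟩
    · exact h (show {M₀} ∈ 𝓝 M₀ by simp)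
    · rintro ⟨N, M⟩ (rfl : M = M₀) h
      simpa using h
  · refine ⟨_, hS, fun b => ⟨M b + N b, ?_⟩⟩
    have hmono : StrictMono fun i => M i + (N i : ℕ) :=
      strictMono_nat_of_lt_succ fun i => (hM i).trans_le (Nat.le_add_right _ _)
    have hN' : StrictMono fun i => (N i : ℕ) := fun i j hij => hN hij
    rintro _ ⟨i, rfl⟩ h
    exact (hmono.le_iff_le.1 h).trans (hN'.le_apply)

/-- The count is at most `N / r + 1`, and `r ≤ N` absorbs the rounding error. -/
theorem card_Ioc_filter_modEq_le {M N r : ℕ} (hr : 0 < r) (hrN : r ≤ N) (v : ℕ) :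
    (((Finset.Ioc M (M + N)).filter (· ≡ v [MOD r])).card : ℝ) ≤ 2 * (N / r) := by
  have hr' : (0 : ℚ) < r := by exact_mod_cast hr
  have h := Nat.Ioc_filter_modEq_card M (M + N) hr v
  have h1 : (1 : ℚ) ≤ N / r := by
    rw [one_le_div hr']
    exact_mod_cast hrN
  have key : (((Finset.Ioc M (M + N)).filter (· ≡ v [MOD r])).card : ℚ) ≤ 2 * (N / r) := by
    have hcast : (((Finset.Ioc M (M + N)).filter (· ≡ v [MOD r])).card : ℚ) =
        ((max (⌊(((M + N : ℕ) : ℚ) - v) / (r : ℚ)⌋ - ⌊((M : ℚ) - v) / (r : ℚ)⌋) 0 : ℤ) : ℚ) := by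
      rw [← h]; simp
    rw [hcast, Int.cast_max]
    refine max_le ?_ (by positivity)
    have h2 := Int.floor_le ((((M + N : ℕ) : ℚ) - v) / (r : ℚ))
    have h3 := Int.lt_floor_add_one (((M : ℚ) - v) / (r : ℚ))
    have h4 : (((M + N : ℕ) : ℚ) - v) / (r : ℚ) = ((M : ℚ) - v) / r + N / r := by
      push_cast; ring
    push_cast at *
    linarith
  have := (Rat.cast_le (K := ℝ)).2 key
  push_cast at this
  exact this

theorem intervalDensity_truncatedProgressions_le {c : ℕ} (hc : 0 < c) {s : ℕ → ℕ}
    {x : ℕ+ × ℕ} (hs : ∀ t, s t ≤ x.2 + x.1 → c * 2 ^ t ≤ (x.1 : ℕ)) :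
    intervalDensity (truncatedProgressions (fun t => c * 2 ^ t) s) x ≤ 4 / c := by
  classical
  obtain ⟨N, M⟩ := x
  have hN : (0 : ℝ) < ((N : ℕ) : ℝ) := by exact_mod_cast N.pos
  have hc' : (0 : ℝ) < c := by exact_mod_cast hc
  simp only at hs
  rw [intervalDensity, div_le_iff₀ hN]
  -- The clause `t ≤ x` bounds `t`, which makes the union finite.
  set T := (Finset.range (M + N + 1)).filter fun t => s t ≤ M + N with hT
  set U := T.biUnion fun t => (Finset.Ioc M (M + N)).filter (· ≡ t [MOD c * 2 ^ t]) with hU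
  have hsub : truncatedProgressions (fun t => c * 2 ^ t) s ∩ Set.Icc (M + 1) (M + N) ⊆ U := by
    rintro y ⟨⟨t, hst, hty, hy⟩, hMy, hyN⟩
    simp only [hU, hT, Finset.coe_biUnion, Set.mem_iUnion, Finset.mem_coe, Finset.mem_filter,
      Finset.mem_range, Finset.mem_Ioc]
    exact ⟨t, ⟨by omega, by omega⟩, ⟨by omega, hyN⟩, hy⟩
  have hcard := Set.ncard_le_ncard hsub U.finite_toSet
  rw [Set.ncard_coe_finset] at hcard
  calc ((truncatedProgressions (fun t => c * 2 ^ t) s ∩ Set.Icc (M + 1) (M + N)).ncard : ℝ)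
      ≤ U.card := by exact_mod_cast hcard
    _ ≤ ∑ t ∈ T, (((Finset.Ioc M (M + N)).filter (· ≡ t [MOD c * 2 ^ t])).card : ℝ) := by
        exact_mod_cast Finset.card_biUnion_le
    _ ≤ ∑ t ∈ T, 2 * (((N : ℕ) : ℝ) / ((c * 2 ^ t : ℕ) : ℝ)) :=
        Finset.sum_le_sum fun t ht =>
          card_Ioc_filter_modEq_le (by positivity) (hs t (Finset.mem_filter.1 ht).2) t
    _ ≤ ∑ t ∈ Finset.range (M + N + 1), 2 * (((N : ℕ) : ℝ) / ((c * 2 ^ t : ℕ) : ℝ)) :=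
        Finset.sum_le_sum_of_subset_of_nonneg (Finset.filter_subset _ _)
          fun _ _ _ => by positivity
    _ = 2 * ((N : ℕ) : ℝ) / c * ∑ t ∈ Finset.range (M + N + 1), (1 / (2 : ℝ)) ^ t := by
        rw [Finset.mul_sum]
        refine Finset.sum_congr rfl fun t _ => ?_
        push_cast
        rw [one_div, inv_pow]
        field_simp
    _ ≤ 2 * ((N : ℕ) : ℝ) / c * 2 := by
        gcongr
        exact sum_geometric_two_le _
    _ = 4 / c * ((N : ℕ) : ℝ) := by ring

/-! ### Measure of `kappa` -/

section Measure

variable [MeasurableSpace (Ultrafilter ℕ)] [BorelSpace (Ultrafilter ℕ)]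
  {μ : Measure (Ultrafilter ℕ)}

theorem IsCountingMeasure.measure_univ (hμ : IsCountingMeasure μ) : μ Set.univ = 1 := by
  obtain ⟨q, -, h⟩ := hμ.exists_ultrafilter
  have huniv : basicOpen Set.univ = Set.univ := Set.eq_univ_of_forall fun p => univ_mem
  have hd : intervalDensity Set.univ = fun _ => 1 := by
    funext x
    have hN : ((x.1 : ℕ) : ℝ) ≠ 0 := by exact_mod_cast x.1.ne_zero
    have : (Set.Icc (x.2 + 1) (x.2 + x.1)).ncard = x.1 := by
      rw [← Finset.coe_Icc, Set.ncard_coe_finset, Nat.card_Icc]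
      omega
    rw [intervalDensity, Set.univ_inter, this, div_self hN]
  have h1 := h Set.univ
  rw [hd, huniv] at h1
  have h2 : μ.real Set.univ = 1 := (tendsto_nhds_unique h1 tendsto_const_nhds)
  rw [measureReal_def] at h2
  exact (ENNReal.toReal_eq_one_iff _).1 h2

theorem IsCountingMeasure.measure_kappa (hμ : IsCountingMeasure μ) : μ kappa = 0 := by
  have : IsProbabilityMeasure μ := ⟨hμ.measure_univ⟩
  obtain ⟨q, hq, h⟩ := hμ.exists_ultrafilter
  obtain ⟨S, hS, hlen⟩ := hq.exists_mem_length
  have hle : ∀ c : ℕ, 0 < c → μ.real kappa ≤ 4 / c := by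
    intro c hc
    -- Intervals of `S` reaching `s t` have length at least the modulus `c * 2 ^ t`.
    choose s hs using fun t : ℕ => hlen (c * 2 ^ t)
    refine (measureReal_mono (kappa_subset_basicOpen_truncatedProgressions
      (b := fun t => c * 2 ^ t) (fun t => by positivity) s)).trans ?_
    refine le_of_tendsto (h _) ?_
    filter_upwards [hS] with x hx
    exact intervalDensity_truncatedProgressions_le hc fun t => hs t x hx
  have hzero : μ.real kappa = 0 := by
    refine le_antisymm ?_ measureReal_nonneg
    refine ge_of_tendsto (tendsto_const_div_atTop_nhds_zero_nat (4 : ℝ)) ?_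
    filter_upwards [eventually_gt_atTop 0] with c hc using hle c hc
  exact (measureReal_eq_zero_iff).1 hzero

end Measure

/-! ### Arithmetic progressions -/

/-- Van der Waerden's theorem for finite colourings of `ℕ`. -/
theorem exists_monochromatic_ap {κ : Type*} [Finite κ] (C : ℕ → κ) (k : ℕ) :
    ∃ c, ContainsAP k (C ⁻¹' {c}) := by
  obtain ⟨b, hb, a, c, h⟩ := Combinatorics.exists_mono_homothetic_copy (Finset.range k) C
  refine ⟨c, a, b, hb, fun j hj => ?_⟩
  have := h j (Finset.mem_range.2 hj)
  rwa [smul_eq_mul, mul_comm, add_comm] at this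

theorem ContainsAP.mono {k : ℕ} {A B : Set ℕ} (hA : ContainsAP k A) (h : A ⊆ B) :
    ContainsAP k B := by
  obtain ⟨a, b, hb, hab⟩ := hA
  exact ⟨a, b, hb, fun j hj => h (hab j hj)⟩

/-- Otherwise compactness covers `ℕ` by finitely many sets without such progressions, a colouring
that contradicts van der Waerden. -/
theorem progressionRich_nonempty (k : ℕ) : (progressionRich k).Nonempty := by
  by_contra hne
  have h : ∀ p : Ultrafilter ℕ, ∃ A ∈ p, ¬ ContainsAP k A := by
    intro p
    by_contra! hp
    exact hne ⟨p, hp⟩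
  choose A hA hAP using h
  obtain ⟨F, hF⟩ := isCompact_univ.elim_finite_subcover (fun p => {u : Ultrafilter ℕ | A p ∈ u})
    (fun p => ultrafilter_isOpen_basic (A p)) fun p _ => Set.mem_iUnion.2 ⟨p, hA p⟩
  have hcover : ∀ n : ℕ, ∃ p : F, n ∈ A p := by
    intro n
    obtain ⟨p, hp, hn⟩ := Set.mem_iUnion₂.1 (hF (Set.mem_univ (pure n : Ultrafilter ℕ)))
    exact ⟨⟨p, hp⟩, hn⟩
  choose C hC using hcover
  obtain ⟨p, hp⟩ := exists_monochromatic_ap C k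
  exact hAP p (hp.mono fun n (hn : C n = p) => hn ▸ hC n)

theorem isTwoSidedIdeal_progressionRich (k : ℕ) : IsTwoSidedIdeal (progressionRich k) where
  nonempty := progressionRich_nonempty k
  add_mem_left p q hq A hA := by
    obtain ⟨m, hm⟩ := (mem_add_iff.1 hA).exists
    obtain ⟨a, b, hb, hab⟩ := hq _ hm
    refine ⟨m + a, b, hb, fun j hj => ?_⟩
    rw [add_assoc]
    exact hab j hj
  add_mem_right p q hq A hA := by
    obtain ⟨a, b, hb, hab⟩ := hq _ (mem_add_iff.1 hA)
    have h : ∀ᶠ n in p, ∀ j ∈ Finset.range k, a + j * b + n ∈ A :=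
      (Filter.eventually_all_finset _).2 fun j hj => hab j (Finset.mem_range.1 hj)
    obtain ⟨n, hn⟩ := h.exists
    refine ⟨a + n, b, hb, fun j hj => ?_⟩
    rw [add_right_comm]
    exact hn j (Finset.mem_range.2 hj)

theorem kappa_subset_progressionRich (k : ℕ) : kappa ⊆ progressionRich k :=
  Set.sInter_subset_of_mem (isTwoSidedIdeal_progressionRich k)

end BetaNat

theorem theorem4p3p4 [MeasurableSpace (Ultrafilter ℕ)] [BorelSpace (Ultrafilter ℕ)] :
    -- `κ(βℕ)` is the smallest two-sided ideal
    IsLeast {I : Set (Ultrafilter ℕ) | BetaNat.IsTwoSidedIdeal I} BetaNat.kappa ∧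
    -- it is a null set for every counting measure
    (∀ μ : Measure (Ultrafilter ℕ), BetaNat.IsCountingMeasure μ → μ BetaNat.kappa = 0) ∧
    -- the inclusion `κ(βℕ) ⊆ AP_k` holds, but bounds `μ(AP_k)` from below only by `0`,
    -- whereas the whole space has measure `1`
    (∀ k : ℕ, BetaNat.kappa ⊆ BetaNat.progressionRich k ∧
      ∀ μ : Measure (Ultrafilter ℕ), BetaNat.IsCountingMeasure μ →
        0 = μ BetaNat.kappa ∧ μ BetaNat.kappa ≤ μ (BetaNat.progressionRich k) ∧
          μ Set.univ = 1) := by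
  exact ⟨BetaNat.isLeast_kappa, fun _ hμ => hμ.measure_kappa, fun k =>
    ⟨BetaNat.kappa_subset_progressionRich k, fun μ hμ => ⟨hμ.measure_kappa.symm,
      measure_mono (BetaNat.kappa_subset_progressionRich k), hμ.measure_univ⟩⟩⟩
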